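/- Let $A$ be a free abelian group that is not finitely generated. A direct summand $M$ of $A$ is called large if $A=M\oplus S$ for some subgroup $S$ with $\operatorname{rank}(S)<\operatorname{rank}(A)$. For a natural number $m\ge 0$ let $\Gamma_A(m)$ be the subgroup of $\operatorname{Aut}(A)$ consisting of all automorphisms $\varphi$ with $\varphi(a)\equiv a \pmod{mA}$ for all $a\in A$, and let $\Lambda_A(m)$ be the subgroup of $\operatorname{Aut}(A)$ consisting of all automorphisms $\varphi$ for which there are a large direct summand $M$ of $A$ and an integer $k$ with $\varphi(x)\equiv kx \pmod{mA}$ for all $x\in M$. Let $\varphi\in\operatorname{Aut}(A)$, and suppose that there is a largest natural number $m$ with $\varphi\in\Lambda_A(m)$ and that $m\ge 2$. Let $N$ be the normal closure of $\varphi$ in $\operatorname{Aut}(A)$. Then $$\Gamma_A(m)\le N\le \Lambda_A(m).$$ -/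

import Mathlib

/-! Abelian groups are treated as `ℤ`-modules, so that the automorphism group of `A` is `A ≃ₗ[ℤ] A`
(multiplication is composition). -/

namespace FreeAb

variable {A : Type*} [AddCommGroup A]

/-- The congruence `a ≡ b (mod m A)`. -/
def CongMod (m : ℕ) (a b : A) : Prop :=
  ∃ c : A, a - b = (m : ℤ) • c

/-- `M` is a large direct summand of `A`: it has a direct complement whose rank (the corank of `M`)
is strictly less than the rank of `A`. -/
def IsLarge (M : Submodule ℤ A) : Prop :=
  ∃ S : Submodule ℤ A, IsCompl M S ∧ Module.rank ℤ S < Module.rank ℤ A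

/-- The principal congruence subgroup of level `m`: all automorphisms `φ` with `φ a ≡ a (mod m A)`
for all `a`. -/
def principalCongruence (A : Type*) [AddCommGroup A] (m : ℕ) : Subgroup (A ≃ₗ[ℤ] A) where
  carrier := {φ | ∀ a : A, CongMod m (φ a) a}
  one_mem' := fun a => ⟨0, by simp⟩
  mul_mem' := by
    intro φ ψ hφ hψ a
    obtain ⟨c, hc⟩ := hφ (ψ a)
    obtain ⟨d, hd⟩ := hψ a
    refine ⟨c + d, ?_⟩
    rw [smul_add, ← hc, ← hd, LinearEquiv.mul_apply]
    abel
  inv_mem' := by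
    intro φ hφ a
    obtain ⟨c, hc⟩ := hφ (φ⁻¹ a)
    refine ⟨-c, ?_⟩
    have h : φ (φ⁻¹ a) = a := φ.apply_symm_apply a
    rw [h] at hc
    rw [smul_neg, ← hc]
    abel

/-- `φ` acts modulo `m` as multiplication by one integer `k` on some large direct summand. -/
def IsAlmostScalarMod (m : ℕ) (φ : A ≃ₗ[ℤ] A) : Prop :=
  ∃ M : Submodule ℤ A, IsLarge M ∧ ∃ k : ℤ, ∀ x ∈ M, CongMod m (φ x) (k • x)

/-- A subgroup of a free abelian group (of any rank) is free. -/
theorem free_submodule {A : Type*} [AddCommGroup A] [Module.Free ℤ A] (P : Submodule ℤ A) :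
    Module.Free ℤ P := by
  classical
  suffices H : ∀ (ι : Type _) (N : Submodule ℤ (ι →₀ ℤ)), Module.Free ℤ N by
    let e := (Module.Free.chooseBasis ℤ A).repr
    have := H _ (P.map e.toLinearMap)
    exact Module.Free.of_equiv (e.submoduleMap P).symm
  intro ι N
  obtain ⟨_, _⟩ := exists_wellFoundedLT ι
  let F : ι → Submodule ℤ (ι →₀ ℤ) := fun i =>
    { carrier := {x | x ∈ N ∧ ∀ j, i < j → x j = 0}
      add_mem' := fun {a b} ha hb => ⟨N.add_mem ha.1 hb.1, fun j hj => by
        simp [ha.2 j hj, hb.2 j hj]⟩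
      zero_mem' := ⟨N.zero_mem, fun _ _ => rfl⟩
      smul_mem' := fun c x hx => ⟨N.smul_mem c hx.1, fun j hj => by simp [hx.2 j hj]⟩ }
  have hgen : ∀ i, ∃ x ∈ F i, ∀ y ∈ F i, ∃ c : ℤ, y i = c * x i := by
    intro i
    let I : Ideal ℤ := (F i).map (Finsupp.lapply i)
    obtain ⟨d, hd⟩ := IsPrincipalIdealRing.principal I
    have hdI : d ∈ I := by rw [hd]; exact Submodule.mem_span_singleton_self d
    obtain ⟨x, hx, hxd⟩ := hdI
    refine ⟨x, hx, fun y hy => ?_⟩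
    have hyI : y i ∈ I := ⟨y, hy, rfl⟩
    rw [hd, Submodule.mem_span_singleton] at hyI
    obtain ⟨c, hc⟩ := hyI
    refine ⟨c, ?_⟩
    rw [← hc, ← hxd]
    rfl
  choose x hxF hx using hgen
  let v : {i // x i i ≠ 0} → (ι →₀ ℤ) := fun i => x i
  have hli : LinearIndependent ℤ v := by
    rw [linearIndependent_iff]
    intro l hl
    by_contra hne
    have hs : l.support.Nonempty := Finsupp.support_nonempty_iff.2 hne
    let i := l.support.max' hs
    have hi : i ∈ l.support := Finset.max'_mem _ hs
    have h0 := DFunLike.congr_fun hl (i : ι)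
    rw [Finsupp.linearCombination_apply, Finsupp.sum, Finsupp.finsetSum_apply,
      Finset.sum_eq_single_of_mem i hi] at h0
    · exact (mul_ne_zero (Finsupp.mem_support_iff.1 hi) i.2) h0
    · intro j hj hji
      have hlt : j < i := lt_of_le_of_ne (Finset.le_max' _ _ hj) hji
      have : x j i = 0 := (hxF j).2 i hlt
      simp [v, this]
  have hsp : ∀ i, ∀ y ∈ F i, y ∈ Submodule.span ℤ (Set.range v) := by
    intro i
    induction i using WellFoundedLT.induction with
    | ind i ih =>
      intro y hy
      have key : ∀ w ∈ F i, w i = 0 → w ∈ Submodule.span ℤ (Set.range v) := by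
        intro w hw hwi
        by_cases hw0 : w = 0
        · rw [hw0]; exact Submodule.zero_mem _
        have hs : w.support.Nonempty := Finsupp.support_nonempty_iff.2 hw0
        have hk := Finset.max'_mem _ hs
        refine ih (w.support.max' hs) ?_ w ⟨hw.1, fun j hj => ?_⟩
        · by_contra hlt
          rcases (not_lt.1 hlt).eq_or_lt with h | h
          · rw [← h] at hk
            exact Finsupp.mem_support_iff.1 hk hwi
          · exact Finsupp.mem_support_iff.1 hk (hw.2 _ h)
        · by_contra hne
          exact absurd (Finset.le_max' _ _ (Finsupp.mem_support_iff.2 hne)) (not_le.2 hj)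
      obtain ⟨c, hc⟩ := hx i y hy
      by_cases hxi : x i i = 0
      · exact key y hy (by rw [hc, hxi, mul_zero])
      · have h1 := key (y - c • x i) ((F i).sub_mem hy ((F i).smul_mem c (hxF i))) (by simp [hc])
        have h2 : x i ∈ Submodule.span ℤ (Set.range v) := Submodule.subset_span ⟨⟨i, hxi⟩, rfl⟩
        have h3 := Submodule.add_mem _ h1 (Submodule.smul_mem _ c h2)
        simpa using h3
  have hN : Submodule.span ℤ (Set.range v) = N := by
    apply le_antisymm
    · rw [Submodule.span_le]
      rintro _ ⟨i, rfl⟩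
      exact (hxF i).1
    · intro y hy
      by_cases hy0 : y = 0
      · rw [hy0]; exact Submodule.zero_mem _
      have hs : y.support.Nonempty := Finsupp.support_nonempty_iff.2 hy0
      refine hsp (y.support.max' hs) y ⟨hy, fun j hj => ?_⟩
      by_contra hne
      exact absurd (Finset.le_max' _ _ (Finsupp.mem_support_iff.2 hne)) (not_le.2 hj)
  rw [← hN]
  exact Module.Free.of_basis (Module.Basis.span hli)

theorem IsLarge.inf [Module.Free ℤ A] (hA : ¬ Module.Finite ℤ A) {M N : Submodule ℤ A}
    (hM : IsLarge M) (hN : IsLarge N) : IsLarge (M ⊓ N) := by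
  obtain ⟨S, hS, hSr⟩ := hM
  obtain ⟨T, hT, hTr⟩ := hN
  let eS := Submodule.quotientEquivOfIsCompl M S hS
  let eT := Submodule.quotientEquivOfIsCompl N T hT
  let f : A →ₗ[ℤ] S × T := (eS.toLinearMap ∘ₗ M.mkQ).prod (eT.toLinearMap ∘ₗ N.mkQ)
  have hf : LinearMap.ker f = M ⊓ N := by
    ext x
    simp [f, LinearMap.ker_prod]
  have e : (A ⧸ (M ⊓ N)) ≃ₗ[ℤ] LinearMap.range f :=
    (Submodule.quotEquivOfEq _ _ hf.symm).trans f.quotKerEquivRange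
  have hSf := free_submodule S
  have hTf := free_submodule T
  have hRf := free_submodule (LinearMap.range f)
  have hfree : Module.Free ℤ (A ⧸ (M ⊓ N)) := Module.Free.of_equiv e.symm
  obtain ⟨U, hU⟩ : ∃ U, IsCompl (M ⊓ N) U := by
    obtain ⟨g, hg⟩ := Module.projective_lifting_property (M ⊓ N).mkQ LinearMap.id
      (Submodule.mkQ_surjective _)
    have hg' : ∀ q, (M ⊓ N).mkQ (g q) = q := fun q => DFunLike.congr_fun hg q
    refine ⟨LinearMap.range g, IsCompl.of_eq ?_ ?_⟩
    · rw [eq_bot_iff]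
      rintro _ ⟨hx, q, rfl⟩
      have h0 : (M ⊓ N).mkQ (g q) = 0 := (Submodule.Quotient.mk_eq_zero _).2 hx
      rw [hg'] at h0
      simp [h0]
    · rw [eq_top_iff]
      intro x _
      have h0 : x - g ((M ⊓ N).mkQ x) ∈ M ⊓ N := by
        rw [← Submodule.Quotient.mk_eq_zero, ← Submodule.mkQ_apply, map_sub, hg', sub_self]
      exact Submodule.mem_sup.2 ⟨_, h0, _, ⟨_, rfl⟩, sub_add_cancel _ _⟩
  refine ⟨U, hU, ?_⟩
  have h1 : Module.rank ℤ U ≤ Module.rank ℤ (S × T) := by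
    rw [← ((Submodule.quotientEquivOfIsCompl _ U hU).symm.trans e).symm.rank_eq]
    exact Submodule.rank_le _
  have h0 : Cardinal.aleph0 ≤ Module.rank ℤ A := by
    by_contra h
    exact hA (Module.rank_lt_aleph0_iff.1 (not_le.1 h))
  refine h1.trans_lt ?_
  rw [rank_prod']
  exact Cardinal.add_lt_of_lt h0 hSr hTr

theorem isCoprime_of_congMod [Module.Free ℤ A] {M : Submodule ℤ A} (hM : IsLarge M) {m : ℕ}
    {φ : A ≃ₗ[ℤ] A} {k : ℤ} (h : ∀ x ∈ M, CongMod m (φ x) (k • x)) : IsCoprime k (m : ℤ) := by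
  obtain ⟨S, hS, hSr⟩ := hM
  have hne : Nontrivial M := by
    rw [Submodule.nontrivial_iff_ne_bot]
    rintro rfl
    have : S = ⊤ := by simpa using hS.sup_eq_top
    subst this
    simp at hSr
  have hMf := free_submodule M
  let b := Module.Free.chooseBasis ℤ M
  obtain ⟨i⟩ := b.index_nonempty
  obtain ⟨z, hz⟩ := h (b i) (b i).2
  let g : A →ₗ[ℤ] ℤ := b.coord i ∘ₗ M.projectionOnto S hS
  refine ⟨g (φ.symm (b i)), g (φ.symm z), ?_⟩
  have hz' : φ (b i) = k • (b i : A) + (m : ℤ) • z := by rw [← hz]; abel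
  have h1 : g (φ.symm (φ (b i))) = 1 := by simp [g]
  rw [hz'] at h1
  simp only [map_add, map_smul, smul_eq_mul] at h1
  linarith

/-- For `A` free of infinite rank, the subgroup of all automorphisms `φ` for which there are a large
direct summand `M` and an integer `k` with `φ x ≡ k x (mod m A)` for all `x ∈ M`. -/
def almostScalar [Module.Free ℤ A] (hA : ¬ Module.Finite ℤ A) (m : ℕ) :
    Subgroup (A ≃ₗ[ℤ] A) where
  carrier := {φ | IsAlmostScalarMod m φ}
  one_mem' := by
    refine ⟨⊤, ⟨⊥, isCompl_top_bot, ?_⟩, 1, fun x _ => ⟨0, by simp⟩⟩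
    rw [rank_bot]
    by_contra h
    have h0 : Module.rank ℤ A = 0 := by simpa using h
    exact hA (Module.rank_lt_aleph0_iff.1 (h0 ▸ Cardinal.aleph0_pos))
  mul_mem' := by
    rintro φ ψ ⟨M, hM, k, hk⟩ ⟨N, hN, l, hl⟩
    refine ⟨M ⊓ N, hM.inf hA hN, l * k, fun x hx => ?_⟩
    obtain ⟨c, hc⟩ := hk x hx.1
    obtain ⟨d, hd⟩ := hl x hx.2
    refine ⟨l • c + φ d, ?_⟩
    have hd' : ψ x = l • x + (m : ℤ) • d := by rw [← hd]; abel
    have hc' : φ x = k • x + (m : ℤ) • c := by rw [← hc]; abel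
    rw [LinearEquiv.mul_apply, hd', map_add, map_smul, map_smul, hc']
    module
  inv_mem' := by
    rintro φ ⟨M, hM, k, hk⟩
    obtain ⟨l, c, hlc⟩ := isCoprime_of_congMod hM hk
    refine ⟨M, hM, l, fun x hx => ?_⟩
    obtain ⟨z, hz⟩ := hk x hx
    have hz' : φ x = k • x + (m : ℤ) • z := by rw [← hz]; abel
    have h1 : x = k • φ.symm x + (m : ℤ) • φ.symm z := by
      conv_lhs => rw [← φ.symm_apply_apply x, hz', map_add, map_smul, map_smul]
    refine ⟨c • φ.symm x - l • φ.symm z, ?_⟩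
    change φ.symm x - l • x = _
    have h2 : φ.symm x = (l * k + c * (m : ℤ)) • φ.symm x := by rw [hlc, one_smul]
    have h3 : l • x = (l * k) • φ.symm x + (l * (m : ℤ)) • φ.symm z := by
      conv_lhs => rw [h1]
      module
    rw [h3]
    nth_rewrite 1 [h2]
    module

end FreeAb

/-! The upper inclusion holds because $\Lambda_A(m)$ is normal. For the lower one, $N$ is shown to
contain an elementary transvection of level $m$, and then all of $\Gamma_A(m)$.

Finding the transvection. On a large summand $\varphi = k + m\delta$, and maximality of $m$ forbids
$\delta$ to be scalar modulo a prime $p$ on any large summand inside it, since otherwise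
$\varphi\in\Lambda_A(mp)$. A gcd argument on 2×2 minors gives $b$ such that $b,\delta b$ span a
rank-two direct summand (`NowhereScalar.exists_alt_eq_one`). Such $b$ exist off any set of fewer
than $\operatorname{rank} A$ coordinates, so $\operatorname{rank} A$ many disjointly supported pairs
split off together: $A = V\oplus V\oplus D$ with $\varphi(v,0,0) = (kv, mv, 0)$
(`exists_level_splitting`). A double commutator then yields the transvection
(`exists_transvection_of_normal`).

From it to $\Gamma_A(m)$. Commutators give all transvections of level $m$ between factors isomorphic
to $A$. Whitehead's lemma gives $\mathrm{diag}(u,u^{-1},1)$, and an Eilenberg swindle removes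
$u^{-1}$ (`diag_one_mem`). This covers every $g\in\Gamma_A(m)$ that fixes pointwise a summand
$B\cong A$ with complement $\cong A$ (`fixing_first_mem`). A general $g$ maps some $B$ into a sum
that misses further copies of $A$ (`exists_avoiding_splitting`), which leaves room to correct it
until it fixes $B$ (`mem_of_map_first`). -/

namespace FreeAb

/-! ### Membership in a normal subgroup, independent of coordinates -/

section Transport

variable {A : Type*} [AddCommGroup A] {W W' : Type*} [AddCommGroup W] [AddCommGroup W']

/-- The automorphisms of `W` that belong to `N` under every identification of `A` with `W`. -/
def transported (N : Subgroup (A ≃ₗ[ℤ] A)) (W : Type*) [AddCommGroup W] :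
    Subgroup (W ≃ₗ[ℤ] W) where
  carrier := {T | ∀ e : A ≃ₗ[ℤ] W, (e.trans T).trans e.symm ∈ N}
  one_mem' := fun e => by
    convert N.one_mem
    ext a
    simp
  mul_mem' := fun {S T} hS hT e => by
    convert N.mul_mem (hS e) (hT e) using 1
    ext a
    simp [LinearEquiv.mul_apply]
  inv_mem' := fun {T} hT e => by
    convert N.inv_mem (hT e) using 1
    rfl

/-- Identifications of `A` with `W'` pull back along `f`. Taking `f` to be a regrouping of factors
lets the decomposition of `A` be changed at will. -/
theorem transported_congr {N : Subgroup (A ≃ₗ[ℤ] A)} (f : W ≃ₗ[ℤ] W') {T : W ≃ₗ[ℤ] W}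
    {T' : W' ≃ₗ[ℤ] W'} (h : ∀ w, f (T w) = T' (f w)) (hT : T ∈ transported N W) :
    T' ∈ transported N W' := by
  intro e
  convert hT (e.trans f.symm) using 1
  ext a
  simp [h]

instance transported_normal (N : Subgroup (A ≃ₗ[ℤ] A)) : (transported N W).Normal where
  conj_mem T hT g := transported_congr g (fun w => by
    have : g⁻¹ (g w) = w := g.symm_apply_apply w
    simp [LinearEquiv.mul_apply, this]) hT

/-- Two identifications differ by an automorphism of `A`, so for normal `N` testing one is enough.
-/
theorem mem_transported_of_mem {N : Subgroup (A ≃ₗ[ℤ] A)} [N.Normal] {φ : A ≃ₗ[ℤ] A} (hφ : φ ∈ N)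
    (e : A ≃ₗ[ℤ] W) : (e.symm.trans φ).trans e ∈ transported N W := by
  intro e'
  convert Subgroup.Normal.conj_mem ‹N.Normal› φ hφ (e.trans e'.symm) using 1
  rfl

theorem mem_of_mem_transported {N : Subgroup (A ≃ₗ[ℤ] A)} {φ : A ≃ₗ[ℤ] A}
    (e : A ≃ₗ[ℤ] W) (h : (e.symm.trans φ).trans e ∈ transported N W) : φ ∈ N := by
  convert h e using 1
  ext a
  simp

end Transport

/-! ### Transvections and the double commutator -/

section Elementary

variable {X Y Z W : Type*} [AddCommGroup X] [AddCommGroup Y] [AddCommGroup Z] [AddCommGroup W]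

/-- The automorphism `1 + f` for `f` of square zero. -/
def unipotent (f : W →ₗ[ℤ] W) (hf : ∀ w, f (f w) = 0) : W ≃ₗ[ℤ] W where
  __ := LinearMap.id + f
  invFun w := w - f w
  left_inv w := by simp [hf]
  right_inv w := by simp [hf]

@[simp] theorem unipotent_apply (f : W →ₗ[ℤ] W) (hf : ∀ w, f (f w) = 0) (w : W) :
    unipotent f hf w = w + f w := rfl

@[simp] theorem unipotent_symm_apply (f : W →ₗ[ℤ] W) (hf : ∀ w, f (f w) = 0) (w : W) :
    (unipotent f hf).symm w = w - f w := rfl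

/-- The elementary automorphism `(a, b, c) ↦ (a, b + x a, c)`. -/
def lowerTransvection (Z : Type*) [AddCommGroup Z] (x : X →ₗ[ℤ] Y) :
    (X × Y × Z) ≃ₗ[ℤ] (X × Y × Z) :=
  unipotent ((LinearMap.inr ℤ X (Y × Z)) ∘ₗ (LinearMap.inl ℤ Y Z) ∘ₗ x ∘ₗ LinearMap.fst ℤ X (Y × Z))
    (fun w => by simp)

/-- The elementary automorphism `(a, b, c) ↦ (a + y b, b, c)`. -/
def upperTransvection (Z : Type*) [AddCommGroup Z] (y : Y →ₗ[ℤ] X) :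
    (X × Y × Z) ≃ₗ[ℤ] (X × Y × Z) :=
  unipotent ((LinearMap.inl ℤ X (Y × Z)) ∘ₗ y ∘ₗ LinearMap.fst ℤ Y Z ∘ₗ LinearMap.snd ℤ X (Y × Z))
    (fun w => by simp)

@[simp] theorem lowerTransvection_apply (x : X →ₗ[ℤ] Y) (w : X × Y × Z) :
    lowerTransvection Z x w = (w.1, w.2.1 + x w.1, w.2.2) := by
  ext <;> simp [lowerTransvection]

@[simp] theorem upperTransvection_apply (y : Y →ₗ[ℤ] X) (w : X × Y × Z) :
    upperTransvection Z y w = (w.1 + y w.2.1, w.2.1, w.2.2) := by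
  ext <;> simp [upperTransvection]

/-- The swap of the first two factors. -/
def swapFirst (X Y Z : Type*) [AddCommGroup X] [AddCommGroup Y] [AddCommGroup Z] :
    (X × Y × Z) ≃ₗ[ℤ] (Y × X × Z) where
  toFun w := (w.2.1, w.1, w.2.2)
  map_add' _ _ := rfl
  map_smul' _ _ := rfl
  invFun w := (w.2.1, w.1, w.2.2)
  left_inv _ := rfl
  right_inv _ := rfl

@[simp] theorem swapFirst_apply (w : X × Y × Z) : swapFirst X Y Z w = (w.2.1, w.1, w.2.2) := rfl

/-- If `φ` lies in a normal subgroup, a double commutator of `φ` with unipotents gives an explicit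
transvection in it. -/
theorem exists_transvection_of_normal {H : Subgroup (W ≃ₗ[ℤ] W)} [hH : H.Normal] {φ : W ≃ₗ[ℤ] W}
    (hφ : φ ∈ H) {ρ y : W →ₗ[ℤ] W} {m : ℤ} (h1 : ∀ w, ρ (ρ w) = 0) (h2 : ∀ w, ρ (y w) = 0)
    (h3 : ∀ w, ρ (φ (y w)) = 0) (h4 : ∀ w, ρ (φ (ρ w)) = m • ρ w) {T : W ≃ₗ[ℤ] W}
    (hT : ∀ w, T w = w + m • y (ρ w)) : T ∈ H := by
  -- Since φ⁻¹uφ = 1 + yρφ, ψ = (1 + yρφ)(1 − φyρ). In the commutator of ψ with τ = 1 + ρ only yρφρ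
  -- = m·yρ survives.
  let u := unipotent (φ.toLinearMap ∘ₗ y ∘ₗ ρ) (fun w => by simp [h3])
  let τ := unipotent ρ h1
  let ψ := φ⁻¹ * (u * φ * u⁻¹)
  have hψ : ψ ∈ H := H.mul_mem (H.inv_mem hφ) (hH.conj_mem φ hφ u)
  have hc : ψ * (τ * ψ⁻¹ * τ⁻¹) ∈ H := H.mul_mem hψ (hH.conj_mem _ (H.inv_mem hψ) τ)
  have hψa : ∀ w, ψ w = w - φ (y (ρ w)) + y (ρ (φ w)) - y (ρ (φ (φ (y (ρ w))))) := by
    intro w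
    change φ.symm (u (φ (u.symm w))) = _
    simp [u]
    abel
  have key : T * τ * ψ = ψ * τ := by
    ext w
    simp only [LinearEquiv.mul_apply, hT, hψa, τ, unipotent_apply, map_add, map_sub, h1, h2, h3, h4,
      map_smul, map_zero]
    simp
    abel
  have : T = ψ * (τ * ψ⁻¹ * τ⁻¹) := by
    rw [← mul_assoc, ← mul_assoc, ← key]
    group
  rwa [this]

theorem exists_eq_smul_of_forall [Module.Free ℤ X] {f : X →ₗ[ℤ] Y} {m : ℤ}
    (h : ∀ a, ∃ c, f a = m • c) : ∃ x : X →ₗ[ℤ] Y, ∀ a, f a = m • x a := by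
  let b := Module.Free.chooseBasis ℤ X
  choose c hc using h
  refine ⟨b.constr ℤ (fun i => c (b i)), fun a => ?_⟩
  have : f = m • b.constr ℤ (fun i => c (b i)) := b.ext fun i => by simp [hc (b i)]
  exact DFunLike.congr_fun this a

end Elementary

/-! ### Commutators and Whitehead's lemma -/

section Elimination

universe u

variable {A : Type u} [AddCommGroup A] {N : Subgroup (A ≃ₗ[ℤ] A)} {m : ℤ}
  {X Y Z : Type u} [AddCommGroup X] [AddCommGroup Y] [AddCommGroup Z]

/-- The elementary commutator relation through `Z`: `s` is the given transvection read as a map X →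
Z of level `m`, `t` is a level-one transvection Z → Y, and the commutator of `t` with `s` is the
transvection by `m • x`. -/
theorem lowerTransvection_mem (hN : lowerTransvection A (m • LinearMap.id) ∈ transported N (A × A × A))
    (eX : X ≃ₗ[ℤ] A) (eY : Y ≃ₗ[ℤ] A) (eZ : Z ≃ₗ[ℤ] A) (x : X →ₗ[ℤ] Y) :
    lowerTransvection Z (m • x) ∈ transported N (X × Y × Z) := by
  let s : (X × Y × Z) ≃ₗ[ℤ] (X × Y × Z) :=
    unipotent ((LinearMap.inr ℤ X (Y × Z)) ∘ₗ (LinearMap.inr ℤ Y Z) ∘ₗ eZ.symm.toLinearMap ∘ₗ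
      (m • eX.toLinearMap) ∘ₗ LinearMap.fst ℤ X (Y × Z)) (fun w => by simp)
  let t : (X × Y × Z) ≃ₗ[ℤ] (X × Y × Z) :=
    unipotent ((LinearMap.inr ℤ X (Y × Z)) ∘ₗ (LinearMap.inl ℤ Y Z) ∘ₗ x ∘ₗ eX.symm.toLinearMap ∘ₗ
      eZ.toLinearMap ∘ₗ LinearMap.snd ℤ Y Z ∘ₗ LinearMap.snd ℤ X (Y × Z)) (fun w => by simp)
  have hs : s ∈ transported N (X × Y × Z) := by
    let f : (A × A × A) ≃ₗ[ℤ] (X × Y × Z) :=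
      (eX.symm.prodCongr ((LinearEquiv.prodComm ℤ A A).trans (eY.symm.prodCongr eZ.symm)))
    refine transported_congr f (fun w => ?_) hN
    ext <;> simp [f, s]
  have hc := Subgroup.mul_mem _ ((transported_normal (W := X × Y × Z) N).conj_mem s hs t)
    (Subgroup.inv_mem _ hs)
  convert hc using 1
  rw [eq_mul_inv_iff_mul_eq, eq_mul_inv_iff_mul_eq]
  ext w <;> simp [LinearEquiv.mul_apply, s, t]
  abel

theorem upperTransvection_mem (hN : lowerTransvection A (m • LinearMap.id) ∈ transported N (A × A × A))
    (eX : X ≃ₗ[ℤ] A) (eY : Y ≃ₗ[ℤ] A) (eZ : Z ≃ₗ[ℤ] A) (y : Y →ₗ[ℤ] X) :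
    upperTransvection Z (m • y) ∈ transported N (X × Y × Z) :=
  transported_congr (swapFirst Y X Z) (fun w => by simp) (lowerTransvection_mem hN eY eX eZ y)

/-- Whitehead's lemma: `diag(u, u⁻¹, 1)` is a product of conjugates of transvections of level `m`. -/
theorem diag_inv_mem (hN : lowerTransvection A (m • LinearMap.id) ∈ transported N (A × A × A))
    (eX : X ≃ₗ[ℤ] A) (eZ : Z ≃ₗ[ℤ] A) (u : X ≃ₗ[ℤ] X) (x x' : X →ₗ[ℤ] X)
    (hx : ∀ a, u a = a + m • x a) (hx' : ∀ a, u.symm a = a + m • x' a) :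
    u.prodCongr (u.symm.prodCongr (LinearEquiv.refl ℤ Z)) ∈ transported N (X × X × Z) := by
  let H := transported N (X × X × Z)
  have hH : H.Normal := transported_normal N
  let U (y : X →ₗ[ℤ] X) := upperTransvection Z y
  let L (y : X →ₗ[ℤ] X) := lowerTransvection Z y
  let v : X →ₗ[ℤ] X := u.toLinearMap
  let v' : X →ₗ[ℤ] X := u.symm.toLinearMap
  have hU : U (m • x) ∈ H := upperTransvection_mem hN eX eX eZ x
  have hL : L (m • (-x')) ∈ H := lowerTransvection_mem hN eX eX eZ (-x')
  -- The word U(v)L(-v')U(v)·U(-1)L(1)U(-1) equals diag(u, u⁻¹, 1). It regroups into conjugates of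
  -- the level-`m` elements U(v − 1) and L(1 − v').
  have h1 := hH.conj_mem _ hU (U v * L (-v'))
  have h2 := hH.conj_mem _ hL (U v)
  have h3 := H.mul_mem (H.mul_mem h1 h2) hU
  convert h3 using 1
  have e1 : U (m • x) = U (v - LinearMap.id) := by
    congr 1; ext a; simp [v, hx]
  have e2 : L (m • (-x')) = L (LinearMap.id - v') := by
    congr 1; ext a; simp [v', hx']
  have Uadd : ∀ y z, U (y + z) = U y * U z := fun y z => by
    ext w <;> simp [U, LinearEquiv.mul_apply]
    abel
  have Ladd : ∀ y z, L (y + z) = L y * L z := fun y z => by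
    ext w <;> simp [L, LinearEquiv.mul_apply]
    abel
  have Uneg : ∀ y, U (-y) = (U y)⁻¹ := fun y => by
    rw [eq_inv_iff_mul_eq_one, ← Uadd]; ext w <;> simp [U]
  have Lneg : ∀ y, L (-y) = (L y)⁻¹ := fun y => by
    rw [eq_inv_iff_mul_eq_one, ← Ladd]; ext w <;> simp [L]
  have hd : u.prodCongr (u.symm.prodCongr (LinearEquiv.refl ℤ Z)) =
      U v * L (-v') * U v * U (-LinearMap.id) * L LinearMap.id * U (-LinearMap.id) := by
    ext w <;> simp [U, L, v, v', LinearEquiv.mul_apply]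
  rw [hd, e1, e2, sub_eq_add_neg, sub_eq_add_neg, Uadd, Ladd, Lneg v', Uneg LinearMap.id]
  have hcomm : L LinearMap.id * (L v')⁻¹ = (L v')⁻¹ * L LinearMap.id := by
    rw [← Lneg, ← Ladd, ← Ladd, add_comm]
  rw [hcomm]
  group

end Elimination
-- The Eilenberg swindle
section Elimination

universe u

variable {A : Type u} [AddCommGroup A] [Module.Free ℤ A] {N : Subgroup (A ≃ₗ[ℤ] A)} {m : ℤ}
  {X Y Z C B : Type u} [AddCommGroup X] [AddCommGroup Y] [AddCommGroup Z] [AddCommGroup C]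
  [AddCommGroup B]

theorem aleph0_le_rank (hA : ¬ Module.Finite ℤ A) : Cardinal.aleph0 ≤ Module.rank ℤ A := by
  by_contra h
  exact hA (Module.rank_lt_aleph0_iff.1 (not_le.1 h))

theorem nonempty_prod_equiv (hA : ¬ Module.Finite ℤ A) [Module.Free ℤ X]
    (hX : Module.rank ℤ X ≤ Module.rank ℤ A) (eY : Y ≃ₗ[ℤ] A) : Nonempty ((X × Y) ≃ₗ[ℤ] A) := by
  have : Module.Free ℤ Y := Module.Free.of_equiv eY.symm
  apply nonempty_linearEquiv_of_rank_eq
  rw [rank_prod', eY.rank_eq]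
  exact Cardinal.add_eq_right (aleph0_le_rank hA) hX

theorem nonempty_finsupp_equiv (hA : ¬ Module.Finite ℤ A) (e : X ≃ₗ[ℤ] A) :
    Nonempty ((ℕ →₀ X) ≃ₗ[ℤ] A) := by
  have : Module.Free ℤ X := Module.Free.of_equiv e.symm
  apply nonempty_linearEquiv_of_rank_eq
  rw [rank_finsupp, e.rank_eq]
  simpa using Cardinal.aleph0_mul_eq (aleph0_le_rank hA)

theorem embDomain_succ_zero (v : ℕ →₀ C) :
    Finsupp.embDomain ⟨Nat.succ, Nat.succ_injective⟩ v 0 = 0 :=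
  Finsupp.embDomain_of_notMem_range _ _ _ (by simp)

theorem embDomain_succ_succ (v : ℕ →₀ C) (n : ℕ) :
    Finsupp.embDomain ⟨Nat.succ, Nat.succ_injective⟩ v (n + 1) = v n :=
  Finsupp.embDomain_apply_self ⟨Nat.succ, Nat.succ_injective⟩ v n

/-- The identification of `C × C^(ℕ)` with `C^(ℕ)`. -/
noncomputable def consEquiv (C : Type*) [AddCommGroup C] : (C × (ℕ →₀ C)) ≃ₗ[ℤ] (ℕ →₀ C) where
  toFun w := Finsupp.embDomain ⟨Nat.succ, Nat.succ_injective⟩ w.2 + Finsupp.single 0 w.1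
  map_add' v w := by
    ext (_ | n) <;> simp [embDomain_succ_zero, embDomain_succ_succ]
  map_smul' k w := by
    ext (_ | n) <;> simp [embDomain_succ_zero, embDomain_succ_succ]
  invFun v := (v 0, Finsupp.comapDomain Nat.succ v Nat.succ_injective.injOn)
  left_inv w := by
    ext <;> simp [embDomain_succ_zero, embDomain_succ_succ]
  right_inv v := by
    ext (_ | n) <;> simp [embDomain_succ_zero, embDomain_succ_succ]

/-- Let Γ be γ on every copy in W = C^(ℕ). Peeling one `C` off the first `W` turns diag(Γ, Γ⁻¹, 1)
into γ ⊕ diag(Γ, Γ⁻¹, 1). Placing an idle `C` in the third factor gives 1 ⊕ diag(Γ, Γ⁻¹, 1)⁻¹. The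
product of the two is γ ⊕ 1. -/
theorem diag_one_mem (hA : ¬ Module.Finite ℤ A)
    (hN : lowerTransvection A (m • LinearMap.id) ∈ transported N (A × A × A))
    (eC : C ≃ₗ[ℤ] A) (eB : B ≃ₗ[ℤ] A) (γ : C ≃ₗ[ℤ] C) (x x' : C →ₗ[ℤ] C)
    (hx : ∀ a, γ a = a + m • x a) (hx' : ∀ a, γ.symm a = a + m • x' a) :
    γ.prodCongr (LinearEquiv.refl ℤ B) ∈ transported N (C × B) := by
  obtain ⟨eW⟩ := nonempty_finsupp_equiv hA eC
  have : Module.Free ℤ (ℕ →₀ C) := Module.Free.of_equiv eW.symm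
  have : Module.Free ℤ C := Module.Free.of_equiv eC.symm
  obtain ⟨eWA⟩ := nonempty_prod_equiv hA eW.rank_eq.le (LinearEquiv.refl ℤ A)
  obtain ⟨eWWA⟩ := nonempty_prod_equiv hA eW.rank_eq.le eWA
  obtain ⟨eCA⟩ := nonempty_prod_equiv hA eC.rank_eq.le (LinearEquiv.refl ℤ A)
  let W := ℕ →₀ C
  let Γ : (ℕ →₀ C) ≃ₗ[ℤ] (ℕ →₀ C) := Finsupp.mapRange.linearEquiv γ
  let ξ : (ℕ →₀ C) →ₗ[ℤ] (ℕ →₀ C) := Finsupp.mapRange.linearMap x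
  let ξ' : (ℕ →₀ C) →ₗ[ℤ] (ℕ →₀ C) := Finsupp.mapRange.linearMap x'
  have hΓ : ∀ w n, Γ w n = γ (w n) := fun _ _ => rfl
  have hξ : ∀ a, Γ a = a + m • ξ a := fun a => by ext n; simp [Γ, ξ, hx]
  have hξ' : ∀ a, Γ.symm a = a + m • ξ' a := fun a => by
    ext n
    simp [Γ, ξ', hx']
  have d1 := diag_inv_mem hN eW (LinearEquiv.refl ℤ A) Γ ξ ξ' hξ hξ'
  have d2 := Subgroup.inv_mem _ (diag_inv_mem hN eW eCA Γ ξ ξ' hξ hξ')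
  let f : (W × W × A) ≃ₗ[ℤ] (C × B) :=
    ((consEquiv C).symm.prodCongr (LinearEquiv.refl ℤ (W × A))).trans
      ((LinearEquiv.prodAssoc ℤ C W (W × A)).trans
        ((LinearEquiv.refl ℤ C).prodCongr (eWWA.trans eB.symm)))
  let g : (W × W × C × A) ≃ₗ[ℤ] (C × B) :=
    (show (W × W × C × A) ≃ₗ[ℤ] (C × W × W × A) from
      { toFun := fun w => (w.2.2.1, w.1, w.2.1, w.2.2.2)
        map_add' := fun _ _ => rfl
        map_smul' := fun _ _ => rfl
        invFun := fun w => (w.2.1, w.2.2.1, w.1, w.2.2.2)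
        left_inv := fun _ => rfl
        right_inv := fun _ => rfl }).trans
        ((LinearEquiv.refl ℤ C).prodCongr (eWWA.trans eB.symm))
  let E : (W × W × A) ≃ₗ[ℤ] B := eWWA.trans eB.symm
  let D : (W × W × A) ≃ₗ[ℤ] (W × W × A) :=
    Γ.prodCongr (Γ.symm.prodCongr (LinearEquiv.refl ℤ A))
  have hcons : ∀ w : W, (consEquiv C).symm (Γ w) =
      (γ ((consEquiv C).symm w).1, Γ ((consEquiv C).symm w).2) := by
    intro w
    ext <;> simp [consEquiv, hΓ]
  have k1 : γ.prodCongr (E.symm.trans (D.trans E)) ∈ transported N (C × B) := by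
    refine transported_congr f (fun w => ?_) d1
    ext <;> simp [f, E, D, hcons]
  have k2 : (LinearEquiv.refl ℤ C).prodCongr (E.symm.trans (D.symm.trans E)) ∈
      transported N (C × B) := by
    refine transported_congr g (T := (Γ.prodCongr (Γ.symm.prodCongr (LinearEquiv.refl ℤ (C × A)))).symm) (fun w => ?_) d2
    ext <;> simp [g, E, D]
  convert Subgroup.mul_mem _ k1 k2 using 1
  ext w <;> simp [LinearEquiv.mul_apply]

end Elimination
-- From transvections to congruence automorphisms
section Elimination

universe u

variable {A : Type u} [AddCommGroup A] [Module.Free ℤ A] {N : Subgroup (A ≃ₗ[ℤ] A)} {m : ℕ}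
  {B C Q Z W : Type u} [AddCommGroup B] [AddCommGroup C] [AddCommGroup Q] [AddCommGroup Z]
  [AddCommGroup W]

theorem exists_eq_add_smul [Module.Free ℤ W] {g : W ≃ₗ[ℤ] W} (hg : g ∈ principalCongruence W m) :
    ∃ G : W →ₗ[ℤ] W, ∀ w, g w = w + (m : ℤ) • G w := by
  obtain ⟨G, hG⟩ := exists_eq_smul_of_forall (X := W) (Y := W) (f := g.toLinearMap - LinearMap.id) (m := m)
    (fun a => by
      obtain ⟨c, hc⟩ := hg a
      exact ⟨c, by simpa using hc⟩)
  exact ⟨G, fun w => by rw [← hG]; simp⟩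

instance principalCongruence_normal : (principalCongruence W m).Normal where
  conj_mem g hg T a := by
    obtain ⟨c, hc⟩ := hg (T⁻¹ a)
    refine ⟨T c, ?_⟩
    have h : T (T⁻¹ a) = a := T.apply_symm_apply a
    rw [← map_smul, ← hc, map_sub, h]
    rfl

/-- Transvections need a spare third factor. Splitting B ≅ A × A provides one: each component of `β`
leaves the other half of `B` idle. -/
theorem unitriangular_mem (hA : ¬ Module.Finite ℤ A)
    (hN : lowerTransvection A ((m : ℤ) • LinearMap.id) ∈ transported N (A × A × A))
    (eB : B ≃ₗ[ℤ] A) (eC : C ≃ₗ[ℤ] A) (β : C →ₗ[ℤ] B) {T : (B × C) ≃ₗ[ℤ] (B × C)}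
    (hT : ∀ w, T w = (w.1 + (m : ℤ) • β w.2, w.2)) : T ∈ transported N (B × C) := by
  obtain ⟨e⟩ := nonempty_prod_equiv hA le_rfl (LinearEquiv.refl ℤ A)
  let f : B ≃ₗ[ℤ] A × A := eB.trans e.symm
  let β₁ : C →ₗ[ℤ] A := LinearMap.fst ℤ A A ∘ₗ f.toLinearMap ∘ₗ β
  let β₂ : C →ₗ[ℤ] A := LinearMap.snd ℤ A A ∘ₗ f.toLinearMap ∘ₗ β
  let s : (A × C × A) ≃ₗ[ℤ] (A × A) × C :=
    { toFun := fun w => ((w.1, w.2.2), w.2.1)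
      map_add' := fun _ _ => rfl
      map_smul' := fun _ _ => rfl
      invFun := fun w => (w.1.1, w.2, w.1.2)
      left_inv := fun _ => rfl
      right_inv := fun _ => rfl }
  let s₁ : (A × C × A) ≃ₗ[ℤ] B × C := s.trans (f.symm.prodCongr (LinearEquiv.refl ℤ C))
  let s₂ : (A × C × A) ≃ₗ[ℤ] B × C :=
    s.trans (((LinearEquiv.prodComm ℤ A A).trans f.symm).prodCongr (LinearEquiv.refl ℤ C))
  have h₁ := upperTransvection_mem hN (LinearEquiv.refl ℤ A) eC (LinearEquiv.refl ℤ A) β₁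
  have h₂ := upperTransvection_mem hN (LinearEquiv.refl ℤ A) eC (LinearEquiv.refl ℤ A) β₂
  have k₁ := transported_congr s₁
    (T' := (s₁.symm.trans (upperTransvection A ((m : ℤ) • β₁))).trans s₁) (fun w => by simp) h₁
  have k₂ := transported_congr s₂
    (T' := (s₂.symm.trans (upperTransvection A ((m : ℤ) • β₂))).trans s₂) (fun w => by simp) h₂
  convert Subgroup.mul_mem _ k₁ k₂ using 1
  apply LinearEquiv.ext
  rintro ⟨b, c⟩
  rw [hT]
  apply (f.prodCongr (LinearEquiv.refl ℤ C)).injective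
  ext <;> simp [LinearEquiv.mul_apply, s, s₁, s₂, β₁, β₂]

/-- Such `g` is block triangular, and its block γ on `C` is invertible because g⁻¹ fixes `B` too.
Hence g = diag(1, γ)·(1 + mβ). -/
theorem fixing_first_mem (hA : ¬ Module.Finite ℤ A)
    (hN : lowerTransvection A ((m : ℤ) • LinearMap.id) ∈ transported N (A × A × A))
    (eB : B ≃ₗ[ℤ] A) (eC : C ≃ₗ[ℤ] A) (g : (B × C) ≃ₗ[ℤ] (B × C))
    (hg : g ∈ principalCongruence (B × C) m) (hfix : ∀ b, g (b, 0) = (b, 0)) :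
    g ∈ transported N (B × C) := by
  have : Module.Free ℤ B := Module.Free.of_equiv eB.symm
  have : Module.Free ℤ C := Module.Free.of_equiv eC.symm
  obtain ⟨G, hG⟩ := exists_eq_add_smul hg
  obtain ⟨G', hG'⟩ := exists_eq_add_smul (Subgroup.inv_mem _ hg)
  have hfix' : ∀ b, g.symm (b, 0) = (b, 0) := fun b => by
    rw [LinearEquiv.symm_apply_eq, hfix]
  let p : C →ₗ[ℤ] C := LinearMap.snd ℤ B C ∘ₗ g.toLinearMap ∘ₗ LinearMap.inr ℤ B C
  let p' : C →ₗ[ℤ] C := LinearMap.snd ℤ B C ∘ₗ g.symm.toLinearMap ∘ₗ LinearMap.inr ℤ B C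
  have split : ∀ w : B × C, ((0 : B), w.2) = w - (w.1, 0) := fun w => by ext <;> simp
  let γ : C ≃ₗ[ℤ] C := LinearEquiv.ofLinearMap p p'
    (by
      ext c
      simp only [p, p', LinearMap.comp_apply, LinearMap.inr_apply, LinearMap.snd_apply,
        LinearEquiv.coe_coe, LinearMap.id_apply]
      rw [split (g.symm (0, c)), map_sub, hfix]
      simp)
    (by
      ext c
      simp only [p, p', LinearMap.comp_apply, LinearMap.inr_apply, LinearMap.snd_apply,
        LinearEquiv.coe_coe, LinearMap.id_apply]
      rw [split (g (0, c)), map_sub, hfix']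
      simp)
  have hd := diag_one_mem hA hN eC eB γ (LinearMap.snd ℤ B C ∘ₗ G ∘ₗ LinearMap.inr ℤ B C)
    (LinearMap.snd ℤ B C ∘ₗ G' ∘ₗ LinearMap.inr ℤ B C)
    (fun c => by
      change (g (0, c)).2 = _
      rw [hG]
      simp)
    (fun c => by
      change (g⁻¹ (0, c)).2 = _
      rw [hG']
      simp)
  have hd' := transported_congr (LinearEquiv.prodComm ℤ C B)
    (T' := (LinearEquiv.refl ℤ B).prodCongr γ) (fun w => by simp) hd
  let β : C →ₗ[ℤ] B := LinearMap.fst ℤ B C ∘ₗ G ∘ₗ LinearMap.inr ℤ B C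
  let U : (B × C) ≃ₗ[ℤ] (B × C) :=
    unipotent (LinearMap.inl ℤ B C ∘ₗ ((m : ℤ) • β) ∘ₗ LinearMap.snd ℤ B C) (fun w => by simp)
  have hU : U ∈ transported N (B × C) :=
    unitriangular_mem hA hN eB eC β (fun w => by ext <;> simp [U])
  convert Subgroup.mul_mem _ hd' hU using 1
  apply LinearEquiv.ext
  rintro ⟨b, c⟩
  have h1 : g (b, c) = g (b, 0) + g (0, c) := by rw [← map_add]; simp
  have h2 : γ c = (g (0, c)).2 := rfl
  rw [h1, hfix, LinearEquiv.mul_apply]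
  ext
  · simp [U, β, hG]
  · simp [U, h2]

/-- A congruence automorphism of level `m` that maps the first factor into the sum of the first and
last factors lies in `N`. -/
theorem mem_of_map_first (hA : ¬ Module.Finite ℤ A)
    (hN : lowerTransvection A ((m : ℤ) • LinearMap.id) ∈ transported N (A × A × A))
    (eB : B ≃ₗ[ℤ] A) (eQ : Q ≃ₗ[ℤ] A) [Module.Free ℤ Z] (hZ : Module.rank ℤ Z ≤ Module.rank ℤ A)
    (g : (B × B × Q × Z) ≃ₗ[ℤ] (B × B × Q × Z))
    (hg : g ∈ principalCongruence (B × B × Q × Z) m) (h₁ : ∀ b, (g (b, 0)).2.1 = 0)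
    (h₂ : ∀ b, (g (b, 0)).2.2.1 = 0) :
    g ∈ transported N (B × B × Q × Z) := by
  have : Module.Free ℤ B := Module.Free.of_equiv eB.symm
  have : Module.Free ℤ Q := Module.Free.of_equiv eQ.symm
  obtain ⟨G, hG⟩ := exists_eq_add_smul hg
  obtain ⟨eZQ⟩ := nonempty_prod_equiv hA hZ eQ
  obtain ⟨eZB⟩ := nonempty_prod_equiv hA hZ eB
  let eBZ := (LinearEquiv.prodComm ℤ B Z).trans eZB
  let eQZ := (LinearEquiv.prodComm ℤ Q Z).trans eZQ
  obtain ⟨eC⟩ := nonempty_prod_equiv hA eB.rank_eq.le eQZ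
  -- A left inverse of b ↦ g(b, 0), which takes values in B × Z.
  let r : (B × Z) →ₗ[ℤ] B := LinearMap.fst ℤ B (B × Q × Z) ∘ₗ g.symm.toLinearMap ∘ₗ
    LinearMap.prodMap LinearMap.id (LinearMap.inr ℤ B (Q × Z) ∘ₗ LinearMap.inr ℤ Q Z)
  let x₁ : B →ₗ[ℤ] B := LinearMap.fst ℤ B (B × Q × Z) ∘ₗ G ∘ₗ LinearMap.inl ℤ B (B × Q × Z)
  let x₂ : B →ₗ[ℤ] Z := LinearMap.snd ℤ Q Z ∘ₗ LinearMap.snd ℤ B (Q × Z) ∘ₗ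
    LinearMap.snd ℤ B (B × Q × Z) ∘ₗ G ∘ₗ LinearMap.inl ℤ B (B × Q × Z)
  let s : ((B × Z) × B × Q) ≃ₗ[ℤ] (B × B × Q × Z) :=
    { toFun := fun w => (w.1.1, w.2.1, w.2.2, w.1.2)
      map_add' := fun _ _ => rfl
      map_smul' := fun _ _ => rfl
      invFun := fun w => ((w.1, w.2.2.2), w.2.1, w.2.2.1)
      left_inv := fun _ => rfl
      right_inv := fun _ => rfl }
  -- On g(b, 0) = (b + m x₁b, 0, 0, m x₂b), `e₁` writes mb into the vacant second factor, `e₂` uses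
  -- that copy to cancel m x₁b and m x₂b, and `e₃` erases it.
  let e₁ : (B × B × Q × Z) ≃ₗ[ℤ] (B × B × Q × Z) :=
    (s.symm.trans (lowerTransvection Q ((m : ℤ) • r))).trans s
  let e₂ : (B × B × Q × Z) ≃ₗ[ℤ] (B × B × Q × Z) :=
    unipotent (-(LinearMap.prod x₁ (LinearMap.inr ℤ B (Q × Z) ∘ₗ LinearMap.inr ℤ Q Z ∘ₗ x₂)) ∘ₗ
      LinearMap.fst ℤ B (Q × Z) ∘ₗ LinearMap.snd ℤ B (B × Q × Z)) (fun w => by simp)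
  let e₃ : (B × B × Q × Z) ≃ₗ[ℤ] (B × B × Q × Z) :=
    lowerTransvection (Q × Z) ((m : ℤ) • -LinearMap.id)
  have E₁ : e₁ ∈ transported N (B × B × Q × Z) :=
    transported_congr s (fun w => by simp [e₁]) (lowerTransvection_mem hN eBZ eB eQ r)
  have E₃ : e₃ ∈ transported N (B × B × Q × Z) := lowerTransvection_mem hN eB eB eQZ _
  have F₁ : e₁ ∈ principalCongruence (B × B × Q × Z) m := fun w =>
    ⟨(0, r (w.1, w.2.2.2), 0, 0), by ext <;> simp [e₁, s]⟩
  have F₃ : e₃ ∈ principalCongruence (B × B × Q × Z) m := fun w =>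
    ⟨(0, - w.1, 0, 0), by ext <;> simp [e₃]⟩
  -- `e₂` need not have level `m`, so it enters by conjugation; `e₂⁻¹` is harmless on g(b, 0), whose
  -- second coordinate vanishes.
  let h := e₃ * (e₂ * e₁ * e₂⁻¹)
  have hh : h ∈ transported N (B × B × Q × Z) :=
    Subgroup.mul_mem _ E₃ ((transported_normal N).conj_mem _ E₁ e₂)
  have hh' : h ∈ principalCongruence (B × B × Q × Z) m :=
    Subgroup.mul_mem _ F₃ (principalCongruence_normal.conj_mem _ F₁ e₂)
  have hfix : ∀ b, (h * g) (b, 0) = (b, 0) := by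
    intro b
    have hgb : g (b, 0) = (b + (m : ℤ) • x₁ b, 0, 0, (m : ℤ) • x₂ b) := by
      ext
      · simp [hG, x₁]
      · simp [h₁]
      · simp [h₂]
      · simp [hG, x₂]
    have hr : r (b + (m : ℤ) • x₁ b, (m : ℤ) • x₂ b) = b := by
      change (g.symm (b + (m : ℤ) • x₁ b, 0, 0, (m : ℤ) • x₂ b)).1 = b
      rw [← hgb]
      simp
    change e₃ (e₂ (e₁ (e₂.symm (g (b, 0))))) = _
    rw [hgb]
    have t₂ : e₂.symm (b + (m : ℤ) • x₁ b, 0, 0, (m : ℤ) • x₂ b) =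
        (b + (m : ℤ) • x₁ b, 0, 0, (m : ℤ) • x₂ b) := by
      ext <;> simp [e₂]
    have t₁ : e₁ (b + (m : ℤ) • x₁ b, 0, 0, (m : ℤ) • x₂ b) =
        (b + (m : ℤ) • x₁ b, (m : ℤ) • b, 0, (m : ℤ) • x₂ b) := by
      rw [natCast_zsmul, natCast_zsmul] at hr
      ext <;> simp [e₁, s, hr]
    have t₃ : e₂ (b + (m : ℤ) • x₁ b, (m : ℤ) • b, 0, (m : ℤ) • x₂ b) =
        (b, (m : ℤ) • b, 0, 0) := by
      ext <;> simp [e₂]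
    rw [t₂, t₁, t₃]
    ext <;> simp [e₃]
  have key := fixing_first_mem hA hN eB eC (h * g) (Subgroup.mul_mem _ hh' hg) hfix
  exact (Subgroup.mul_mem_cancel_left _ hh).1 key

end Elimination
-- Disjoint families of finite sets
section Combinatorics

universe u

open Cardinal in
/-- If a family of finite sets has a member disjoint from every set of cardinality less than `#I`,
then it contains `#I` pairwise disjoint members. -/
theorem exists_pairwise_disjoint_family {I : Type u} [Infinite I] (Good : Finset I → Prop)
    (hne : ∀ S, Good S → S.Nonempty)
    (h : ∀ X : Set I, #X < #I → ∃ S, Good S ∧ Disjoint (S : Set I) X) :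
    ∃ s : I → Finset I, (∀ i, Good (s i)) ∧ Pairwise (Function.onFun Disjoint s) := by
  -- If a maximal family had fewer than #I members, so would its union have fewer than #I elements,
  -- and another good set could be added.
  obtain ⟨F, hF⟩ := zorn_subset {F : Set (Finset I) | (∀ S ∈ F, Good S) ∧ F.PairwiseDisjoint id}
    (fun c hc hchain => ⟨⋃₀ c, ⟨fun S ⟨G, hG, hS⟩ => (hc hG).1 S hS,
      (Set.pairwiseDisjoint_sUnion hchain.directedOn).2 fun G hG => (hc hG).2⟩,
      fun G hG => Set.subset_sUnion_of_mem hG⟩)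
  have hcard : #I ≤ #F := by
    by_contra hlt
    rw [not_le] at hlt
    have hX : #(⋃ S ∈ F, (S : Set I)) < #I := by
      rcases lt_or_ge #F ℵ₀ with hfin | hinf
      · have : F.Finite := Cardinal.lt_aleph0_iff_set_finite.1 hfin
        exact (Cardinal.lt_aleph0_iff_set_finite.2
          (this.biUnion fun S _ => S.finite_toSet)).trans_le (Cardinal.aleph0_le_mk I)
      · refine (Cardinal.mk_biUnion_le _ _).trans_lt (lt_of_le_of_lt ?_ hlt)
        refine (mul_le_mul_right (ciSup_le' fun S => ?_) _).trans
          (Cardinal.mul_aleph0_eq hinf).le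
        exact (Cardinal.lt_aleph0_iff_set_finite.2 S.1.finite_toSet).le
    obtain ⟨S, hS, hd⟩ := h _ hX
    have hSF : S ∈ F := by
      refine hF.2 (y := insert S F) ⟨?_, ?_⟩ (Set.subset_insert _ _) (Set.mem_insert _ _)
      · rintro T (rfl | hT)
        · exact hS
        · exact hF.1.1 T hT
      · refine hF.1.2.insert fun T hT _ => ?_
        have := Set.disjoint_iUnion₂_right.1 hd T hT
        exact Finset.disjoint_coe.1 this
    have := Set.disjoint_iUnion₂_right.1 hd S hSF
    exact (hne S hS).ne_empty (by simpa using this)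
  obtain ⟨e⟩ := (Cardinal.le_def _ _).1 hcard
  refine ⟨fun i => e i, fun i => hF.1.1 _ (e i).2, fun i j hij => ?_⟩
  exact hF.1.2 (e i).2 (e j).2 fun h => hij (e.injective (Subtype.ext h))

end Combinatorics

/-! ### Splitting off many pairs at once -/

section Splitting

variable {A V I : Type*} [AddCommGroup A] [AddCommGroup V]

/-- A module with a retraction `r` onto `V` is the product of `V` and the kernel of `r`. -/
def splitEquiv (i : V →ₗ[ℤ] A) (r : A →ₗ[ℤ] V) (h : ∀ v, r (i v) = v) :
    A ≃ₗ[ℤ] V × LinearMap.ker r where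
  toFun a := (r a, ⟨a - i (r a), by simp [h]⟩)
  map_add' a b := by
    ext
    · simp
    · simp
      abel
  map_smul' k a := by
    ext
    · simp
    · simp [smul_sub]
  invFun w := i w.1 + w.2
  left_inv a := by simp
  right_inv w := by
    have : r w.2 = 0 := w.2.2
    ext <;> simp [h, this]

variable (β : Module.Basis I ℤ A) (s : I → Finset I)

open Classical in
/-- The homomorphism that agrees with `single i (f i ·)` on vectors supported on `s i`, for pairwise
disjoint `s i`. -/
noncomputable def collect (f : I → A →ₗ[ℤ] ℤ) : A →ₗ[ℤ] (I →₀ ℤ) :=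
  β.constr ℤ fun j => if h : ∃ i, j ∈ s i then Finsupp.single h.choose (f h.choose (β j)) else 0

theorem collect_apply {s : I → Finset I} (hs : Pairwise (Function.onFun Disjoint s))
    (f : I → A →ₗ[ℤ] ℤ) {i : I} {v : A} (hv : (β.repr v).support ⊆ s i) :
    collect β s f v = Finsupp.single i (f i v) := by
  have hv' : v ∈ Submodule.span ℤ (β '' (s i : Set I)) :=
    β.mem_span_image.2 (by exact_mod_cast hv)
  refine LinearMap.eqOn_span (f := collect β s f) (g := Finsupp.lsingle i ∘ₗ f i) ?_ hv'
  rintro _ ⟨j, hj, rfl⟩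
  have hex : ∃ i, j ∈ s i := ⟨i, hj⟩
  have hi : hex.choose = i := by
    by_contra hne
    exact Finset.disjoint_left.1 (hs hne) hex.choose_spec hj
  simp only [collect, Module.Basis.constr_basis, dif_pos hex, LinearMap.comp_apply,
    Finsupp.lsingle_apply]
  rw [hi]

/-- Pairwise disjointly supported pairs of vectors with dual pairs of functionals split off. -/
theorem exists_splitting {s : I → Finset I} (hs : Pairwise (Function.onFun Disjoint s))
    {x y : I → A} {f g : I → A →ₗ[ℤ] ℤ} (hx : ∀ i, (β.repr (x i)).support ⊆ s i)
    (hy : ∀ i, (β.repr (y i)).support ⊆ s i) (hfx : ∀ i, f i (x i) = 1) (hfy : ∀ i, f i (y i) = 0)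
    (hgx : ∀ i, g i (x i) = 0) (hgy : ∀ i, g i (y i) = 1) :
    ∃ (D : Submodule ℤ A) (e : A ≃ₗ[ℤ] ((I →₀ ℤ) × (I →₀ ℤ)) × D),
      (∀ i, e (x i) = ((Finsupp.single i 1, 0), 0)) ∧
      (∀ i, e (y i) = ((0, Finsupp.single i 1), 0)) ∧
      ∀ i v, (β.repr v).support ⊆ s i → (e v).1.2 = Finsupp.single i (g i v) := by
  let ix := Finsupp.linearCombination ℤ x
  let iy := Finsupp.linearCombination ℤ y
  -- Disjointness of the `s i` glues all `f i` and `g i` into a single retraction onto the span of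
  -- the `x i` and `y i`.
  let r := (collect β s f).prod (collect β s g)
  have hrx : ∀ i, r (x i) = (Finsupp.single i 1, 0) := fun i => by
    simp [r, collect_apply β hs f (hx i), collect_apply β hs g (hx i), hfx, hgx]
  have hry : ∀ i, r (y i) = (0, Finsupp.single i 1) := fun i => by
    simp [r, collect_apply β hs f (hy i), collect_apply β hs g (hy i), hfy, hgy]
  have hr : r ∘ₗ ix.coprod iy = LinearMap.id := by
    ext <;> simp [ix, iy, hrx, hry]
  have hr' : ∀ v, r (ix.coprod iy v) = v := fun v => DFunLike.congr_fun hr v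
  refine ⟨LinearMap.ker r, splitEquiv (ix.coprod iy) r hr', fun i => ?_, fun i => ?_,
    fun i v hv => ?_⟩
  · ext1
    · exact hrx i
    · ext
      simp [splitEquiv, hrx, ix]
  · ext1
    · exact hry i
    · ext
      simp [splitEquiv, hry, iy]
  · exact collect_apply β hs g hv

end Splitting

/-! ### Large summands and nowhere scalar maps -/

section Large

universe u

variable {A : Type u} [AddCommGroup A]

/-- The range is free, so `f` splits over it. -/
theorem isLarge_ker {F : Type u} [AddCommGroup F] [Module.Free ℤ F] (f : A →ₗ[ℤ] F)
    (hF : Module.rank ℤ F < Module.rank ℤ A) : IsLarge (LinearMap.ker f) := by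
  have := free_submodule (LinearMap.range f)
  obtain ⟨g, hg⟩ := Module.projective_lifting_property f.rangeRestrict LinearMap.id
    f.surjective_rangeRestrict
  have hg' : ∀ q, f.rangeRestrict (g q) = q := fun q => DFunLike.congr_fun hg q
  refine ⟨LinearMap.range g, IsCompl.of_eq ?_ ?_, ?_⟩
  · rw [eq_bot_iff]
    rintro _ ⟨hx, q, rfl⟩
    have h0 : f.rangeRestrict (g q) = 0 := Subtype.ext hx
    rw [hg'] at h0
    simp [h0]
  · rw [eq_top_iff]
    intro x _
    have h0 : x - g (f.rangeRestrict x) ∈ LinearMap.ker f := by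
      rw [← LinearMap.ker_rangeRestrict, LinearMap.mem_ker, map_sub, hg', sub_self]
    exact Submodule.mem_sup.2 ⟨_, h0, _, ⟨_, rfl⟩, sub_add_cancel _ _⟩
  · exact ((rank_range_le g).trans (Submodule.rank_le _)).trans_lt hF

variable {I : Type u} (β : Module.Basis I ℤ A)

/-- The vectors `a` such that `δ a` vanishes at all coordinates in `X`. -/
noncomputable def vanishing (X : Set I) (δ : A →ₗ[ℤ] A) : Submodule ℤ A :=
  LinearMap.ker (Finsupp.lsubtypeDomain X ∘ₗ β.repr.toLinearMap ∘ₗ δ)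

theorem mem_vanishing {X : Set I} {δ : A →ₗ[ℤ] A} {a : A} :
    a ∈ vanishing β X δ ↔ ∀ i ∈ X, β.repr (δ a) i = 0 := by
  simp only [vanishing, LinearMap.mem_ker, Finsupp.ext_iff, Subtype.forall]
  rfl

theorem isLarge_vanishing {X : Set I} (hX : Cardinal.mk X < Cardinal.mk I) (δ : A →ₗ[ℤ] A) :
    IsLarge (vanishing β X δ) := by
  apply isLarge_ker
  have h : Module.rank ℤ (X →₀ ℤ) = Cardinal.mk X := by simp
  rw [h, ← β.mk_eq_rank'']
  exact hX

theorem IsLarge.exists_functional [Module.Free ℤ A] {M : Submodule ℤ A} (hM : IsLarge M) :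
    ∃ a ∈ M, ∃ f : A →ₗ[ℤ] ℤ, f a = 1 := by
  obtain ⟨S, hS, hSr⟩ := hM
  have hne : Nontrivial M := by
    rw [Submodule.nontrivial_iff_ne_bot]
    rintro rfl
    have : S = ⊤ := by simpa using hS.sup_eq_top
    subst this
    simp at hSr
  have hMf := free_submodule M
  let b := Module.Free.chooseBasis ℤ M
  obtain ⟨i⟩ := b.index_nonempty
  exact ⟨b i, (b i).2, b.coord i ∘ₗ M.projectionOnto S hS, by simp⟩

/-- `δ` is not scalar modulo any prime on any large summand inside `M`. -/
def NowhereScalar (M : Submodule ℤ A) (δ : A →ₗ[ℤ] A) : Prop :=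
  ∀ p : ℕ, p.Prime → ∀ M' ≤ M, IsLarge M' → ∀ k : ℤ, ¬ ∀ x ∈ M', CongMod p (δ x) (k • x)

theorem NowhereScalar.mono {M M' : Submodule ℤ A} {δ : A →ₗ[ℤ] A} (h : NowhereScalar M δ)
    (hM : M' ≤ M) : NowhereScalar M' δ :=
  fun p hp M'' hM'' => h p hp M'' (hM''.trans hM)

/-- The alternating form `f ∧ g`. -/
def wedge (f g : A →ₗ[ℤ] ℤ) : A →ₗ[ℤ] A →ₗ[ℤ] ℤ :=
  LinearMap.mk₂ ℤ (fun x y => f x * g y - f y * g x) (fun x x' y => by simp; ring)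
    (fun c x y => by simp; ring) (fun x y y' => by simp; ring) (fun c x y => by simp; ring)

theorem wedge_apply (f g : A →ₗ[ℤ] ℤ) (x y : A) : wedge f g x y = f x * g y - f y * g x := rfl

/-- Otherwise fix `a` in `M` with f(a) = 1 and put k = f(δa). Polarising at `a` shows δy ≡ ky modulo
`p` on the large summand of `M` where f(δy) = k f(y). -/
theorem NowhereScalar.exists_not_dvd [Module.Free ℤ A] (hA : ¬ Module.Finite ℤ A)
    {M : Submodule ℤ A}
    (hM : IsLarge M) {δ : A →ₗ[ℤ] A} (h : NowhereScalar M δ) {p : ℕ} (hp : p.Prime) :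
    ∃ w ∈ M, ∃ ω : A →ₗ[ℤ] A →ₗ[ℤ] ℤ, ω.IsAlt ∧ ¬ (p : ℤ) ∣ ω w (δ w) := by
  by_contra! hcon
  obtain ⟨a, ha, f, hfa⟩ := hM.exists_functional
  let k := f (δ a)
  let t : A →ₗ[ℤ] ℤ := f ∘ₗ (δ - k • LinearMap.id)
  have hrank : Module.rank ℤ (ULift.{u} ℤ) < Module.rank ℤ A :=
    (Module.rank_lt_aleph0 ℤ _).trans_le (aleph0_le_rank hA)
  have hlarge := hM.inf hA
    (isLarge_ker (ULift.moduleEquiv.symm.toLinearMap ∘ₗ t : A →ₗ[ℤ] ULift.{u} ℤ) hrank)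
  refine h p hp _ inf_le_left hlarge k fun y hy => ?_
  have hty : t y = 0 := by simpa using hy.2
  have key : ∀ g : A →ₗ[ℤ] ℤ, (p : ℤ) ∣ g (δ y - k • y) := by
    intro g
    have halt : (wedge f g).IsAlt := fun x => by simp [wedge_apply]
    obtain ⟨c₁, h₁⟩ := hcon a ha _ halt
    obtain ⟨c₂, h₂⟩ := hcon y hy.1 _ halt
    obtain ⟨c₃, h₃⟩ := hcon (a + y) (M.add_mem ha hy.1) _ halt
    have hfy : f (δ y) = k * f y := by
      have : f (δ y) - k * f y = 0 := by simpa [t] using hty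
      linarith
    have hk : f (δ a) = k := rfl
    rw [wedge_apply] at h₁ h₂ h₃
    simp only [map_add, hfa, hfy, hk] at h₁ h₂ h₃
    refine ⟨c₃ - c₁ - c₂ - f y * c₁, ?_⟩
    simp only [map_sub, map_smul, smul_eq_mul]
    linear_combination h₃ - h₂ - h₁ - f y * h₁
  let b := Module.Free.chooseBasis ℤ A
  have key' : ∀ i, (p : ℤ) ∣ b.repr (δ y - k • y) i := fun i => key (b.coord i)
  choose c hc using key'
  have hp0 : (p : ℤ) ≠ 0 := by exact_mod_cast hp.ne_zero
  refine ⟨b.repr.symm (Finsupp.onFinset (b.repr (δ y - k • y)).support c fun i hi => ?_), ?_⟩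
  · rw [Finsupp.mem_support_iff, hc]
    exact mul_ne_zero hp0 hi
  · apply b.repr.injective
    ext i
    rw [hc, map_smul]
    simp

/-- The ideal of values at `(b, c)` of alternating forms. -/
def minorIdeal (b c : A) : Ideal ℤ where
  carrier := {n | ∃ ω : A →ₗ[ℤ] A →ₗ[ℤ] ℤ, ω.IsAlt ∧ ω b c = n}
  add_mem' := by
    rintro _ _ ⟨ω, hω, rfl⟩ ⟨ω', hω', rfl⟩
    exact ⟨ω + ω', fun x => by simp [hω.self_eq_zero x, hω'.self_eq_zero x], by simp⟩
  zero_mem' := ⟨0, fun x => by simp, by simp⟩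
  smul_mem' := by
    rintro k _ ⟨ω, hω, rfl⟩
    exact ⟨k • ω, fun x => by simp [hω.self_eq_zero x], by simp⟩

open Classical in
/-- The coordinate projection onto the coordinates in `X`. -/
noncomputable def coordProj (X : Set I) : A →ₗ[ℤ] A :=
  β.constr ℤ fun i => if i ∈ X then β i else 0

theorem coordProj_of_support {X : Set I} {a : A} (ha : ∀ i ∉ X, β.repr a i = 0) :
    coordProj β X a = a := by
  have ha' : a ∈ Submodule.span ℤ (β '' X) := β.mem_span_image.2 fun i hi => by
    by_contra h
    exact Finsupp.mem_support_iff.1 hi (ha i h)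
  refine LinearMap.eqOn_span (f := coordProj β X) (g := LinearMap.id) ?_ ha'
  rintro _ ⟨i, hi, rfl⟩
  simp [coordProj, hi]

theorem coordProj_eq_zero {X : Set I} {a : A} (ha : ∀ i ∈ X, β.repr a i = 0) :
    coordProj β X a = 0 := by
  have ha' : a ∈ Submodule.span ℤ (β '' Xᶜ) := β.mem_span_image.2 fun i hi h =>
    Finsupp.mem_support_iff.1 hi (ha i h)
  refine LinearMap.eqOn_span (f := coordProj β X) (g := 0) ?_ ha'
  rintro _ ⟨i, hi, rfl⟩
  have : i ∉ X := hi
  simp [coordProj, this]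

/-- A nowhere scalar endomorphism has a vector `b` such that `b` and `δ b` span a rank two direct
summand. -/
theorem NowhereScalar.exists_alt_eq_one [Module.Free ℤ A] (hA : ¬ Module.Finite ℤ A)
    {M : Submodule ℤ A}
    (hM : IsLarge M) {δ : A →ₗ[ℤ] A} (h : NowhereScalar M δ) :
    ∃ b ∈ M, ∃ ω : A →ₗ[ℤ] A →ₗ[ℤ] ℤ, ω.IsAlt ∧ ω b (δ b) = 1 := by
  classical
  let β := Module.Free.chooseBasis ℤ A
  -- Choose `b` with maximal ideal of minors. If a prime `p` divided that ideal, adding to `b` a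
  -- disjointly supported `w` with a minor prime to `p` would enlarge it.
  obtain ⟨_, ⟨b, hb, rfl⟩, hmax⟩ := (wellFounded_gt (α := Ideal ℤ)).has_min
    ((fun b => minorIdeal b (δ b)) '' M) ⟨_, 0, M.zero_mem, rfl⟩
  suffices htop : minorIdeal b (δ b) = ⊤ by
    have : (1 : ℤ) ∈ minorIdeal b (δ b) := by rw [htop]; trivial
    exact ⟨b, hb, this⟩
  by_contra htop
  obtain ⟨n, hn⟩ := IsPrincipalIdealRing.principal (minorIdeal b (δ b))
  obtain ⟨p, hp, hpn⟩ := Nat.exists_prime_and_dvd (n := n.natAbs) fun h1 => htop <| by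
    rw [hn]
    exact Ideal.span_singleton_eq_top.2 (Int.isUnit_iff_natAbs_eq.2 h1)
  have hdvd : ∀ z ∈ minorIdeal b (δ b), (p : ℤ) ∣ z := fun z hz => by
    rw [hn] at hz
    exact (Int.natCast_dvd.2 hpn).trans (Ideal.mem_span_singleton.1 hz)
  let X : Set (Module.Free.ChooseBasisIndex ℤ A) := ↑((β.repr b).support ∪ (β.repr (δ b)).support)
  have hX : Cardinal.mk X < Cardinal.mk (Module.Free.ChooseBasisIndex ℤ A) := by
    rw [β.mk_eq_rank'']
    exact (Cardinal.lt_aleph0_iff_set_finite.2 (Finset.finite_toSet _)).trans_le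
      (aleph0_le_rank hA)
  let M' := M ⊓ (vanishing β X LinearMap.id ⊓ vanishing β X δ)
  have hM' : IsLarge M' :=
    hM.inf hA ((isLarge_vanishing β hX _).inf hA (isLarge_vanishing β hX _))
  obtain ⟨w, hw, ω₁, hω₁, hpw⟩ := (h.mono (inf_le_left : M' ≤ M)).exists_not_dvd hA hM' hp
  have pb : coordProj β X b = b := coordProj_of_support β fun i hi => by
    by_contra hne
    exact hi (by simp [X, hne])
  have pδb : coordProj β X (δ b) = δ b := coordProj_of_support β fun i hi => by
    by_contra hne
    exact hi (by simp [X, hne])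
  have pw : coordProj β X w = 0 := coordProj_eq_zero β ((mem_vanishing β).1 hw.2.1)
  have pδw : coordProj β X (δ w) = 0 := coordProj_eq_zero β ((mem_vanishing β).1 hw.2.2)
  refine hmax _ ⟨b + w, M.add_mem hb hw.1, rfl⟩ (lt_of_le_of_ne ?_ fun heq => hpw (hdvd _ ?_))
  · rintro _ ⟨ω, hω, rfl⟩
    -- Projecting onto `X` kills `w` and `δ w`, so the minors of `b` persist; below, projecting away
    -- from `X` recovers those of `w`.
    refine ⟨ω.compl₁₂ (coordProj β X) (coordProj β X), fun x => ?_, ?_⟩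
    · simp [hω.self_eq_zero]
    · simp [pb, pδb, pw, pδw]
  · change minorIdeal b (δ b) = minorIdeal (b + w) (δ (b + w)) at heq
    rw [heq]
    refine ⟨ω₁.compl₁₂ (LinearMap.id - coordProj β X) (LinearMap.id - coordProj β X),
      fun x => ?_, ?_⟩
    · rw [LinearMap.compl₁₂_apply]
      exact hω₁.self_eq_zero _
    · simp [pb, pδb, pw, pδw]

end Large
-- The two decompositions of A and the theorem
universe u

variable {A : Type u} [AddCommGroup A] [Module.Free ℤ A]

instance almostScalar_normal (hA : ¬ Module.Finite ℤ A) (m : ℕ) : (almostScalar hA m).Normal where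
  conj_mem := by
    rintro φ ⟨M, ⟨S, hS, hSr⟩, k, hk⟩ T
    refine ⟨M.map T.toLinearMap, ⟨S.map T.toLinearMap, ?_, ?_⟩, k, ?_⟩
    · exact hS.map (Submodule.orderIsoMapComap T)
    · rwa [← (T.submoduleMap S).rank_eq]
    · rintro _ ⟨x, hx, rfl⟩
      obtain ⟨c, hc⟩ := hk x hx
      refine ⟨T c, ?_⟩
      have h : T⁻¹ (T x) = x := T.symm_apply_apply x
      simp only [LinearEquiv.mul_apply, LinearEquiv.coe_coe, h]
      rw [← map_smul, ← map_smul, ← hc, map_sub]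

/-- Modulo its level, `φ` is scalar with nowhere scalar remainder. -/
theorem exists_nowhereScalar (hA : ¬ Module.Finite ℤ A) {φ : A ≃ₗ[ℤ] A} {m : ℕ} (hm : 0 < m)
    (hmax : IsGreatest {n : ℕ | φ ∈ almostScalar hA n} m) :
    ∃ (M : Submodule ℤ A) (k : ℤ) (δ : A →ₗ[ℤ] A), IsLarge M ∧
      (∀ x ∈ M, φ x = k • x + (m : ℤ) • δ x) ∧ NowhereScalar M δ := by
  obtain ⟨M, hM, k, hk⟩ := hmax.1
  obtain ⟨S, hS, -⟩ := id hM
  have := free_submodule M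
  obtain ⟨δ, hδ⟩ := exists_eq_smul_of_forall (X := M) (Y := A) (m := m)
    (f := (φ.toLinearMap - k • LinearMap.id) ∘ₗ M.subtype)
    (fun x => by
      obtain ⟨c, hc⟩ := hk x x.2
      exact ⟨c, by simpa using hc⟩)
  have hφ : ∀ x ∈ M, φ x = k • x + (m : ℤ) • (δ ∘ₗ M.projectionOnto S hS) x := by
    intro x hx
    have h1 : M.projectionOnto S hS x = ⟨x, hx⟩ := Submodule.projectionOnto_apply_left hS ⟨x, hx⟩
    rw [LinearMap.comp_apply, h1, ← hδ]
    simp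
  refine ⟨M, k, _, hM, hφ, fun p hp M' hM' hlarge s hs => ?_⟩
  -- If δ ≡ s modulo `p`, then φ ≡ k + ms modulo `mp`, against the maximality of `m`.
  have hmem : φ ∈ almostScalar hA (m * p) := by
    refine ⟨M', hlarge, k + m * s, fun x hx => ?_⟩
    obtain ⟨c, hc⟩ := hs x hx
    refine ⟨c, ?_⟩
    rw [hφ x (hM' hx), sub_eq_iff_eq_add.1 hc, Nat.cast_mul]
    module
  have h2 := hp.two_le
  have h3 := hmax.2 hmem
  nlinarith

theorem infinite_of_not_finite {A I : Type*} [AddCommGroup A] (β : Module.Basis I ℤ A)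
    (hA : ¬ Module.Finite ℤ A) : Infinite I := by
  by_contra h
  rw [not_infinite_iff_finite] at h
  exact hA (Module.Finite.of_basis β)

theorem exists_level_splitting {I : Type u} (β : Module.Basis I ℤ A)
    (hA : ¬ Module.Finite ℤ A) {φ : A ≃ₗ[ℤ] A} {m : ℕ} (hm : 0 < m)
    (hmax : IsGreatest {n : ℕ | φ ∈ almostScalar hA n} m) :
    ∃ (D : Submodule ℤ A) (e : A ≃ₗ[ℤ] ((I →₀ ℤ) × (I →₀ ℤ)) × D) (k : ℤ),
      ∀ v, e (φ (e.symm ((v, 0), 0))) = ((k • v, (m : ℤ) • v), 0) := by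
  classical
  have := infinite_of_not_finite β hA
  obtain ⟨M, k, δ, hM, hφ, hδ⟩ := exists_nowhereScalar hA hm hmax
  have hm0 : (m : ℤ) ≠ 0 := by exact_mod_cast hm.ne'
  obtain ⟨s, hs, hdisj⟩ := exists_pairwise_disjoint_family
    (fun S : Finset I => ∃ (b c : A) (f g : A →ₗ[ℤ] ℤ), φ b = k • b + (m : ℤ) • c ∧
      (β.repr b).support ⊆ S ∧ (β.repr c).support ⊆ S ∧ f b = 1 ∧ f c = 0 ∧ g b = 0 ∧ g c = 1)
    (by
      rintro S ⟨b, c, f, g, -, hb, -, hf, -⟩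
      by_contra hne
      rw [Finset.not_nonempty_iff_eq_empty] at hne
      have : b = 0 := by simpa [hne] using hb
      simp [this] at hf)
    (by
      intro X hX
      have hlarge := hM.inf hA ((isLarge_vanishing β hX LinearMap.id).inf hA
        (isLarge_vanishing β hX φ.toLinearMap))
      obtain ⟨b, hb, ω, hω, h1⟩ := (hδ.mono inf_le_left).exists_alt_eq_one hA hlarge
      have hb0 := (mem_vanishing β).1 hb.2.1
      have hφb0 := (mem_vanishing β).1 hb.2.2
      -- m·δb = φb − kb and m ≠ 0, so δb avoids `X` as soon as `b` and φb do.
      have hc0 : ∀ i ∈ X, β.repr (δ b) i = 0 := fun i hi => by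
        have h0 := hφb0 i hi
        rw [LinearEquiv.coe_coe, hφ b hb.1, map_add, map_smul, map_smul] at h0
        have h0' : β.repr b i = 0 := hb0 i hi
        simpa [h0', hm0, hm.ne'] using h0
      -- ω(·, δb) and ω(b, ·) are dual to the pair b, δb because ω is alternating with ω(b, δb) = 1.
      refine ⟨(β.repr b).support ∪ (β.repr (δ b)).support, ⟨b, δ b, ω.flip (δ b), ω b, hφ b hb.1,
        Finset.subset_union_left, Finset.subset_union_right, h1, hω _, hω _, h1⟩, ?_⟩
      rw [Set.disjoint_left]
      intro i hi hiX
      have h0' : β.repr b i = 0 := hb0 i hiX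
      simp [h0', hc0 i hiX] at hi)
  choose b c f g hbc hb hc hfb hfc hgb hgc using hs
  obtain ⟨D, e, heb, hec, -⟩ := exists_splitting β hdisj hb hc hfb hfc hgb hgc
  refine ⟨D, e, k, fun v => ?_⟩
  let F : (I →₀ ℤ) →ₗ[ℤ] ((I →₀ ℤ) × (I →₀ ℤ)) × D :=
    (e.toLinearMap ∘ₗ φ.toLinearMap ∘ₗ e.symm.toLinearMap) ∘ₗ LinearMap.inl ℤ _ _ ∘ₗ
      LinearMap.inl ℤ _ _
  let G : (I →₀ ℤ) →ₗ[ℤ] ((I →₀ ℤ) × (I →₀ ℤ)) × D :=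
    LinearMap.inl ℤ _ _ ∘ₗ LinearMap.prod (k • LinearMap.id) ((m : ℤ) • LinearMap.id)
  have hFG : F = G := by
    refine Finsupp.lhom_ext' fun i => LinearMap.ext_ring ?_
    change e (φ (e.symm ((Finsupp.single i 1, 0), 0))) =
      ((k • Finsupp.single i 1, (m : ℤ) • Finsupp.single i 1), 0)
    rw [← heb i, e.symm_apply_apply, hbc, map_add, map_smul, map_smul, heb, hec]
    ext1
    · ext1 <;> simp
    · simp
  exact DFunLike.congr_fun hFG v

/-- Each `b` is paired with a basis vector `β q` outside the supports of `b` and φb. Its coordinate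
kills φb, so the images of the `b`'s have no component along the `β q`'s. -/
theorem exists_avoiding_splitting {I : Type u} (β : Module.Basis I ℤ A)
    (hA : ¬ Module.Finite ℤ A) (φ : A ≃ₗ[ℤ] A) :
    ∃ (D : Submodule ℤ A) (e : A ≃ₗ[ℤ] ((I →₀ ℤ) × (I →₀ ℤ)) × D),
      ∀ v, (e (φ (e.symm ((v, 0), 0)))).1.2 = 0 := by
  classical
  have := infinite_of_not_finite β hA
  obtain ⟨s, hs, hdisj⟩ := exists_pairwise_disjoint_family
    (fun S : Finset I => ∃ (b c : A) (f g : A →ₗ[ℤ] ℤ), (β.repr (φ b)).support ⊆ S ∧ g (φ b) = 0 ∧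
      (β.repr b).support ⊆ S ∧ (β.repr c).support ⊆ S ∧ f b = 1 ∧ f c = 0 ∧ g b = 0 ∧ g c = 1)
    (by
      rintro S ⟨b, c, f, g, -, -, hb, -, hf, -⟩
      by_contra hne
      rw [Finset.not_nonempty_iff_eq_empty] at hne
      have : b = 0 := by simpa [hne] using hb
      simp [this] at hf)
    (by
      intro X hX
      have hlarge := (isLarge_vanishing β hX LinearMap.id).inf hA
        (isLarge_vanishing β hX φ.toLinearMap)
      obtain ⟨b, hb, f, hf⟩ := hlarge.exists_functional
      have hb0 : ∀ i ∈ X, β.repr b i = 0 := (mem_vanishing β).1 hb.1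
      have hφb0 : ∀ i ∈ X, β.repr (φ b) i = 0 := (mem_vanishing β).1 hb.2
      obtain ⟨q, hq⟩ : ∃ q, q ∉ X ∪ ((β.repr b).support ∪ (β.repr (φ b)).support : Finset I) := by
        by_contra! hall
        have huniv : X ∪ ((β.repr b).support ∪ (β.repr (φ b)).support : Finset I) = Set.univ :=
          Set.eq_univ_of_forall hall
        have hlt := (Cardinal.mk_union_le X
          ((β.repr b).support ∪ (β.repr (φ b)).support : Finset I)).trans_lt
          (Cardinal.add_lt_of_lt (Cardinal.aleph0_le_mk I) hX
            ((Cardinal.lt_aleph0_iff_set_finite.2 (Finset.finite_toSet _)).trans_le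
              (Cardinal.aleph0_le_mk I)))
        rw [huniv, Cardinal.mk_univ] at hlt
        exact hlt.false
      have hqX : q ∉ X := fun h => hq (Or.inl h)
      have hqb : β.repr b q = 0 := by
        by_contra h
        exact hq (Or.inr (by simp [h]))
      have hqφ : β.repr (φ b) q = 0 := by
        by_contra h
        exact hq (Or.inr (by simp [h]))
      -- Subtracting f(β q) times the `q`-coordinate makes `f` vanish at `β q` without changing f(b)
      -- = 1.
      refine ⟨insert q ((β.repr b).support ∪ (β.repr (φ b)).support),
        ⟨b, β q, f - f (β q) • β.coord q, β.coord q, ?_, by simp [hqφ], ?_, ?_, by simp [hf, hqb],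
          by simp, by simp [hqb], by simp⟩, ?_⟩
      · exact Finset.subset_union_right.trans (Finset.subset_insert _ _)
      · exact Finset.subset_union_left.trans (Finset.subset_insert _ _)
      · rw [β.repr_self]
        exact Finsupp.support_single_subset.trans (by simp)
      · rw [Set.disjoint_left]
        intro i hi hiX
        have hiq : i ≠ q := fun h => hqX (h ▸ hiX)
        simp [hb0 i hiX, hφb0 i hiX, hiq] at hi)
  choose b c f g hφb hgφ hb hc hfb hfc hgb hgc using hs
  obtain ⟨D, e, heb, -, heg⟩ := exists_splitting β hdisj hb hc hfb hfc hgb hgc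
  refine ⟨D, e, fun v => ?_⟩
  let F : (I →₀ ℤ) →ₗ[ℤ] (I →₀ ℤ) := LinearMap.snd ℤ _ _ ∘ₗ LinearMap.fst ℤ _ _ ∘ₗ
    (e.toLinearMap ∘ₗ φ.toLinearMap ∘ₗ e.symm.toLinearMap) ∘ₗ LinearMap.inl ℤ _ _ ∘ₗ
      LinearMap.inl ℤ _ _
  have hF : F = 0 := by
    refine Finsupp.lhom_ext' fun i => LinearMap.ext_ring ?_
    change (e (φ (e.symm ((Finsupp.single i 1, 0), 0)))).1.2 = 0
    rw [← heb i, e.symm_apply_apply, heg i _ (hφb i), hgφ, Finsupp.single_zero]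
  exact DFunLike.congr_fun hF v

/-- The normal closure of an automorphism of level `m` contains an elementary transvection of
level `m`. -/
theorem lowerTransvection_mem_transported (hA : ¬ Module.Finite ℤ A) {φ : A ≃ₗ[ℤ] A} {m : ℕ}
    (hm : 0 < m) (hmax : IsGreatest {n : ℕ | φ ∈ almostScalar hA n} m)
    {N : Subgroup (A ≃ₗ[ℤ] A)} [N.Normal] (hφ : φ ∈ N) :
    lowerTransvection A ((m : ℤ) • LinearMap.id) ∈ transported N (A × A × A) := by
  let β := Module.Free.chooseBasis ℤ A
  obtain ⟨D, e, k, he⟩ := exists_level_splitting β hA hm hmax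
  have hD := free_submodule D
  obtain ⟨eAA⟩ := nonempty_prod_equiv hA le_rfl (LinearEquiv.refl ℤ A)
  let V := Module.Free.ChooseBasisIndex ℤ A →₀ ℤ
  let c : V ≃ₗ[ℤ] A × A := β.repr.symm.trans eAA.symm
  let e' : A ≃ₗ[ℤ] ((A × A) × (A × A)) × D :=
    e.trans ((c.prodCongr c).prodCongr (LinearEquiv.refl ℤ D))
  let Φ := (e'.symm.trans φ).trans e'
  have hΦ : Φ ∈ transported N (((A × A) × (A × A)) × D) := mem_transported_of_mem hφ e'
  have hΦv : ∀ v, Φ ((v, 0), 0) = ((k • v, (m : ℤ) • v), 0) := by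
    intro v
    have h1 : e'.symm ((v, 0), 0) = e.symm ((c.symm v, 0), 0) := by
      simp [e']
    change e' (φ (e'.symm ((v, 0), 0))) = _
    rw [h1]
    change ((c.prodCongr c).prodCongr (LinearEquiv.refl ℤ D)) (e (φ _)) = _
    rw [he]
    simp
  let W := ((A × A) × (A × A)) × D
  -- Each V is halved as A × A. `ρ` sends the first half of the second V to the first half of the
  -- first V, and `y` sends that to the second half of the first V. From φ(v, 0) = (kv, mv) follow
  -- ρφρ = mρ and ρφy = 0, the halving being what makes the latter vanish.
  let ρ : W →ₗ[ℤ] W := LinearMap.inl ℤ _ _ ∘ₗ LinearMap.inl ℤ _ _ ∘ₗ LinearMap.inl ℤ _ _ ∘ₗ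
    LinearMap.fst ℤ _ _ ∘ₗ LinearMap.snd ℤ _ _ ∘ₗ LinearMap.fst ℤ _ _
  let y : W →ₗ[ℤ] W := LinearMap.inl ℤ _ _ ∘ₗ LinearMap.inl ℤ _ _ ∘ₗ LinearMap.inr ℤ _ _ ∘ₗ
    LinearMap.fst ℤ _ _ ∘ₗ LinearMap.fst ℤ _ _ ∘ₗ LinearMap.fst ℤ _ _
  have hρ : ∀ w, ρ w = (((w.1.2.1, 0), 0), 0) := fun w => rfl
  have hy : ∀ w, y w = (((0, w.1.1.1), 0), 0) := fun w => rfl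
  obtain ⟨eZ⟩ := nonempty_prod_equiv hA (Submodule.rank_le D) eAA
  let s : W ≃ₗ[ℤ] A × A × A :=
    LinearEquiv.trans
      { toFun := fun w => (w.1.2.1, w.1.1.2, w.2, w.1.1.1, w.1.2.2)
        map_add' := fun _ _ => rfl
        map_smul' := fun _ _ => rfl
        invFun := fun w => (((w.2.2.2.1, w.2.1), (w.1, w.2.2.2.2)), w.2.2.1)
        left_inv := fun _ => rfl
        right_inv := fun _ => rfl }
      ((LinearEquiv.refl ℤ A).prodCongr ((LinearEquiv.refl ℤ A).prodCongr eZ))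
  have hs : ∀ w, s w = (w.1.2.1, w.1.1.2, eZ (w.2, w.1.1.1, w.1.2.2)) := fun w => rfl
  refine transported_congr s
    (T := (s.trans (lowerTransvection A ((m : ℤ) • LinearMap.id))).trans s.symm)
    (fun w => by simp) ?_
  have := transported_normal (W := W) N
  refine exists_transvection_of_normal (m := m) hΦ (ρ := ρ) (y := y) (fun w => ?_) (fun w => ?_)
    (fun w => ?_) (fun w => ?_) (fun w => ?_)
  · rw [hρ, hρ]
    rfl
  · rw [hy, hρ]
    rfl
  · rw [hy, hΦv, hρ]
    simp
  · rw [hρ w, hΦv, hρ]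
    simp
  · rw [LinearEquiv.trans_apply, LinearEquiv.trans_apply, LinearEquiv.symm_apply_eq, hρ, hy,
      lowerTransvection_apply, hs, hs]
    simp

/-- The copy of V that `g` avoids is cut into two copies of `A`, which serve as the vacant factors
in `mem_of_map_first`. -/
theorem principalCongruence_le (hA : ¬ Module.Finite ℤ A) {m : ℕ} {N : Subgroup (A ≃ₗ[ℤ] A)}
    (hN : lowerTransvection A ((m : ℤ) • LinearMap.id) ∈ transported N (A × A × A)) :
    principalCongruence A m ≤ N := by
  intro g hg
  let β := Module.Free.chooseBasis ℤ A
  obtain ⟨D, e, he⟩ := exists_avoiding_splitting β hA g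
  have hD := free_submodule D
  obtain ⟨eAA⟩ := nonempty_prod_equiv hA le_rfl (LinearEquiv.refl ℤ A)
  let V := Module.Free.ChooseBasisIndex ℤ A →₀ ℤ
  let c : V ≃ₗ[ℤ] A × A := β.repr.symm.trans eAA.symm
  let s : ((A × (A × A)) × D) ≃ₗ[ℤ] A × A × A × D :=
    { toFun := fun w => (w.1.1, w.1.2.1, w.1.2.2, w.2)
      map_add' := fun _ _ => rfl
      map_smul' := fun _ _ => rfl
      invFun := fun w => ((w.1, w.2.1, w.2.2.1), w.2.2.2)
      left_inv := fun _ => rfl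
      right_inv := fun _ => rfl }
  let e' : A ≃ₗ[ℤ] A × A × A × D :=
    (e.trans ((β.repr.symm.prodCongr c).prodCongr (LinearEquiv.refl ℤ D))).trans s
  have he' : ∀ a, e' a = (β.repr.symm (e a).1.1, (c (e a).1.2).1, (c (e a).1.2).2, (e a).2) :=
    fun a => rfl
  have hsymm : ∀ b, e'.symm (b, 0) = e.symm ((β.repr b, 0), 0) := fun b => by
    rw [LinearEquiv.symm_apply_eq, he']
    simp
    rfl
  apply mem_of_mem_transported e'
  apply mem_of_map_first hA hN (LinearEquiv.refl ℤ A) (LinearEquiv.refl ℤ A) (Submodule.rank_le D)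
  · intro w
    obtain ⟨x, hx⟩ := hg (e'.symm w)
    refine ⟨e' x, ?_⟩
    rw [← map_smul, ← hx]
    simp
  · intro b
    change (e' (g (e'.symm (b, 0)))).2.1 = 0
    rw [hsymm, he', he]
    simp
  · intro b
    change (e' (g (e'.symm (b, 0)))).2.2.1 = 0
    rw [hsymm, he', he]
    simp

end FreeAb

theorem mainTheorem6 {A : Type*} [AddCommGroup A] [Module.Free ℤ A]
    (hA : ¬ Module.Finite ℤ A) (φ : A ≃ₗ[ℤ] A) (m : ℕ) (hm : 2 ≤ m)
    (hmax : IsGreatest {n : ℕ | φ ∈ FreeAb.almostScalar hA n} m) :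
    FreeAb.principalCongruence A m ≤ Subgroup.normalClosure {φ} ∧
      Subgroup.normalClosure {φ} ≤ FreeAb.almostScalar hA m := by
  constructor
  · exact FreeAb.principalCongruence_le hA (FreeAb.lowerTransvection_mem_transported hA
      (by omega) hmax (Subgroup.subset_normalClosure rfl))
  · have := FreeAb.almostScalar_normal hA m
    exact Subgroup.normalClosure_le_normal (Set.singleton_subset_iff.2 hmax.1)
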